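/- For a finite Borel measure $\nu$ on $\mathbb{C}$ whose support is compact and infinite, let $\varphi_n(z;\nu)$ ($n\ge 0$) be its orthonormal polynomials: $\deg\varphi_n=n$, $\int\varphi_n\overline{\varphi_m}\,d\nu=\delta_{mn}$, with leading coefficient $\kappa_n(\nu)>0$. Let $M=M(\nu)$ be the bounded operator on $\ell^2(\mathbb{N})$ given by the matrix $M_{jk}=\int z\,\varphi_{k-1}(z;\nu)\overline{\varphi_{j-1}(z;\nu)}\,d\nu(z)$ ($j,k\ge1$), i.e. multiplication by $z$ on the closure of the polynomials in $L^2(\nu)$, written in the orthonormal basis $\{\varphi_n(\cdot;\nu)\}_{n\ge0}$. Let $\mathcal{R}$ be the right shift on $\ell^2(\mathbb{N})$. **Theorem.** Let $P$ be a monic polynomial of degree $q\ge 1$ with complex coefficients and let $r>0$. Let $\mu$ be a finite Borel measure on $\mathbb{C}$ with compact and infinite support that is concentrated on $\{z:|P(z)|\le r\}$. Suppose that for each compact set $K\subseteq\{z:|P(z)|<r\}$ there is a constant $C_K<\infty$ such that $$\sum_{n=0}^{\infty}|\varphi_n(z;|P|^2\mu)|^2<C_K\qquad\text{for all } z\in K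 .$$ Then the operators $(P(M)-r\mathcal{R}^q)\mathcal{R}^n$, where $M=M(\mu)$, converge strongly to $0$ on $\ell^2(\mathbb{N})$ as $n\to\infty$; in particular $\kappa_n(\mu)/\kappa_{n+q}(\mu)\to r$ as $n\to\infty$. -/

import Mathlib

open MeasureTheory Filter Topology Polynomial
open scoped ENNReal NNReal ComplexConjugate InnerProductSpace lp

noncomputable section

namespace Bergman

/-! ### Orthonormal polynomials of a measure on the complex plane -/

/-- The `L²(ν)` pairing of two polynomials, linear in the second argument. -/
def polyInner (ν : Measure ℂ) (p q : ℂ[X]) : ℂ :=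
  ∫ z, conj (p.eval z) * q.eval z ∂ν

/-- The monic orthogonal polynomials `Φ_n(·; ν)`: Gram-Schmidt applied to `1, z, z², …`. -/
def monicOrthoPoly (ν : Measure ℂ) (n : ℕ) : ℂ[X] :=
  X ^ n - ∑ k : Fin n,
    C (polyInner ν (monicOrthoPoly ν k) (X ^ n) /
      polyInner ν (monicOrthoPoly ν k) (monicOrthoPoly ν k)) * monicOrthoPoly ν k
termination_by n
decreasing_by all_goals exact k.2

/-- The orthonormal polynomials `φ_n(·; ν) = Φ_n / ‖Φ_n‖`. -/
def orthoPoly (ν : Measure ℂ) (n : ℕ) : ℂ[X] :=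
  C (((Real.sqrt (∫ z, ‖(monicOrthoPoly ν n).eval z‖ ^ 2 ∂ν))⁻¹ : ℝ) : ℂ) * monicOrthoPoly ν n

/-- The leading coefficient `κ_n(ν)` of `φ_n(·; ν)` (a positive real number for measures of
compact infinite support, see `leadingCoeff_orthoPoly` and `kappa_pos`). -/
def kappa (ν : Measure ℂ) (n : ℕ) : ℝ := (orthoPoly ν n).leadingCoeff.re

/-- The measure `|P|² μ`. -/
def sqAbsMeasure (P : ℂ[X]) (μ : Measure ℂ) : Measure ℂ :=
  μ.withDensity fun z => ‖P.eval z‖ₑ ^ 2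

lemma monic_natDegree_monicOrthoPoly (ν : Measure ℂ) (n : ℕ) :
    (monicOrthoPoly ν n).Monic ∧ (monicOrthoPoly ν n).natDegree = n := by
  induction n using Nat.strong_induction_on with
  | _ n ih =>
    have hlt : (∑ k : Fin n,
        C (polyInner ν (monicOrthoPoly ν k) (X ^ n) /
          polyInner ν (monicOrthoPoly ν k) (monicOrthoPoly ν k)) * monicOrthoPoly ν k).degree
        < (n : WithBot ℕ) := by
      refine lt_of_le_of_lt (degree_sum_le _ _) ?_
      refine (Finset.sup_lt_iff (WithBot.bot_lt_coe n)).2 fun k _ => ?_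
      rw [← smul_eq_C_mul]
      refine lt_of_le_of_lt (degree_smul_le _ _) ?_
      rw [degree_eq_natDegree (ih k k.2).1.ne_zero, (ih k k.2).2]
      exact WithBot.coe_lt_coe.2 k.2
    rw [monicOrthoPoly]
    refine ⟨monic_X_pow_sub hlt, ?_⟩
    have h := degree_sub_eq_left_of_degree_lt (p := (X ^ n : ℂ[X])) (by simpa using hlt)
    rw [degree_X_pow] at h
    exact natDegree_eq_of_degree_eq_some h

/-! ### The space `𝒫` and multiplication by `z` -/

section Space

variable {μ : Measure ℂ}

lemma ae_norm_le_of_isCompact_support (hc : IsCompact μ.support) :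
    ∃ B : ℝ, ∀ᵐ z ∂μ, ‖z‖ ≤ B := by
  obtain ⟨B, hB⟩ := hc.isBounded.exists_norm_le
  exact ⟨B, by filter_upwards [Measure.support_mem_ae (μ := μ)] with z hz using hB z hz⟩

lemma memLp_id_top (hc : IsCompact μ.support) : MemLp (fun z : ℂ => z) ∞ μ := by
  obtain ⟨B, hB⟩ := ae_norm_le_of_isCompact_support hc
  exact memLp_top_of_bound measurable_id.aestronglyMeasurable B hB

/-- Multiplication by `z` on `L²(μ)`. -/
def mulZ (hc : IsCompact μ.support) : Lp ℂ 2 μ →L[ℂ] Lp ℂ 2 μ :=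
  (ContinuousLinearMap.mul ℂ ℂ).holderL μ ∞ 2 2 ((memLp_id_top hc).toLp _)

lemma coeFn_mulZ (hc : IsCompact μ.support) (f : Lp ℂ 2 μ) :
    mulZ hc f =ᵐ[μ] fun z => z * f z := by
  have h := (ContinuousLinearMap.mul ℂ ℂ).coeFn_holder (r := 2) ((memLp_id_top hc).toLp _) f
  filter_upwards [h, (memLp_id_top hc).coeFn_toLp] with z hz hz'
  rw [mulZ, ContinuousLinearMap.holderL_apply_apply, hz, hz']
  rfl

variable [IsFiniteMeasure μ]

lemma memLp_poly (hc : IsCompact μ.support) (p : ℂ[X]) :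
    MemLp (fun z : ℂ => p.eval z) 2 μ := by
  obtain ⟨B, hB⟩ := (hc.image p.continuous).isBounded.exists_norm_le
  refine MemLp.of_bound p.continuous.aestronglyMeasurable B ?_
  filter_upwards [Measure.support_mem_ae (μ := μ)] with z hz
  exact hB _ ⟨z, hz, rfl⟩

/-- A polynomial as an element of `L²(μ)`. -/
def polyToL2 (hc : IsCompact μ.support) : ℂ[X] →ₗ[ℂ] Lp ℂ 2 μ where
  toFun p := (memLp_poly hc p).toLp _
  map_add' p q := by
    rw [← MemLp.toLp_add]
    exact MemLp.toLp_congr _ _ (by simp [Filter.EventuallyEq])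
  map_smul' c p := by
    rw [RingHom.id_apply, ← MemLp.toLp_const_smul]
    exact MemLp.toLp_congr _ _ (by simp [Filter.EventuallyEq])

/-- The closure `𝒫` of the polynomials in `L²(μ)`. -/
def polySpace (hc : IsCompact μ.support) : Submodule ℂ (Lp ℂ 2 μ) :=
  (LinearMap.range (polyToL2 hc)).topologicalClosure

instance (hc : IsCompact μ.support) : CompleteSpace (polySpace hc) :=
  (Submodule.isClosed_topologicalClosure _).completeSpace_coe

lemma mulZ_polyToL2 (hc : IsCompact μ.support) (p : ℂ[X]) :
    mulZ hc (polyToL2 hc p) = polyToL2 hc (X * p) := by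
  refine Lp.ext ?_
  filter_upwards [coeFn_mulZ hc (polyToL2 hc p), (memLp_poly hc p).coeFn_toLp,
    (memLp_poly hc (X * p)).coeFn_toLp] with z h1 h2 h3
  rw [h1]
  change z * ((memLp_poly hc p).toLp _ : ℂ → ℂ) z = ((memLp_poly hc (X * p)).toLp _ : ℂ → ℂ) z
  rw [h2, h3]
  simp

lemma mulZ_mem (hc : IsCompact μ.support) : ∀ f ∈ polySpace hc, mulZ hc f ∈ polySpace hc := by
  intro f hf
  refine map_mem_closure (mulZ hc).continuous hf ?_
  rintro _ ⟨p, rfl⟩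
  exact ⟨X * p, (mulZ_polyToL2 hc p).symm⟩

/-- Multiplication by `z` on `𝒫`. -/
def mulZPoly (hc : IsCompact μ.support) : polySpace hc →L[ℂ] polySpace hc :=
  (mulZ hc).restrict (mulZ_mem hc)

/-! ### The orthonormal polynomials form an orthonormal basis of `𝒫` -/

lemma inner_polyToL2 (hc : IsCompact μ.support) (p q : ℂ[X]) :
    ⟪polyToL2 hc p, polyToL2 hc q⟫_ℂ = polyInner μ p q := by
  rw [L2.inner_def, polyInner]
  refine integral_congr_ae ?_
  filter_upwards [(memLp_poly hc p).coeFn_toLp, (memLp_poly hc q).coeFn_toLp] with z h1 h2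
  change ⟪((memLp_poly hc p).toLp _ : ℂ → ℂ) z, ((memLp_poly hc q).toLp _ : ℂ → ℂ) z⟫_ℂ = _
  rw [h1, h2]
  simp [mul_comm]

lemma norm_polyToL2 (hc : IsCompact μ.support) (p : ℂ[X]) :
    ‖polyToL2 hc p‖ = Real.sqrt (∫ z, ‖p.eval z‖ ^ 2 ∂μ) := by
  have h : ((‖polyToL2 hc p‖ ^ 2 : ℝ) : ℂ) = ((∫ z, ‖p.eval z‖ ^ 2 ∂μ : ℝ) : ℂ) := by
    have h1 := inner_self_eq_norm_sq_to_K (𝕜 := ℂ) (polyToL2 hc p)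
    rw [inner_polyToL2, polyInner] at h1
    rw [← integral_complex_ofReal]
    push_cast
    refine Eq.trans h1.symm (integral_congr_ae (Eventually.of_forall fun z => ?_))
    exact Complex.conj_mul' _
  rw [← Complex.ofReal_injective h, Real.sqrt_sq (norm_nonneg _)]

lemma polyToL2_injective (hc : IsCompact μ.support) (hi : μ.support.Infinite) :
    Function.Injective (polyToL2 hc) := by
  rw [injective_iff_map_eq_zero]
  intro p hp
  by_contra hne
  have h0 : ∀ᵐ z ∂μ, p.eval z = 0 := by
    have h1 : (polyToL2 hc p : ℂ → ℂ) =ᵐ[μ] 0 := by rw [hp]; exact Lp.coeFn_zero _ _ _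
    filter_upwards [h1, (memLp_poly hc p).coeFn_toLp] with z h1 h2
    exact h2.symm.trans h1
  refine hi ((p.rootSet_finite ℂ).subset ?_)
  refine (Measure.support_subset_of_isClosed (t := {z | p.eval z = 0})
    (isClosed_eq p.continuous continuous_const) h0).trans fun z hz => ?_
  rw [mem_rootSet]
  exact ⟨hne, by simpa using hz⟩

lemma linearIndependent_monomials (hc : IsCompact μ.support) (hi : μ.support.Infinite) :
    LinearIndependent ℂ fun n : ℕ => polyToL2 hc (X ^ n) := by
  have h : LinearIndependent ℂ fun n : ℕ => (X ^ n : ℂ[X]) := by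
    simpa [← monomial_one_right_eq_X_pow] using (basisMonomials ℂ).linearIndependent
  exact h.map' _ (LinearMap.ker_eq_bot.2 (polyToL2_injective hc hi))

lemma polyToL2_monicOrthoPoly (hc : IsCompact μ.support) (n : ℕ) :
    polyToL2 hc (monicOrthoPoly μ n) =
      InnerProductSpace.gramSchmidt ℂ (fun n : ℕ => polyToL2 hc (X ^ n)) n := by
  induction n using Nat.strong_induction_on with
  | _ n ih =>
    rw [InnerProductSpace.gramSchmidt_def, monicOrthoPoly, map_sub, map_sum]
    congr 1
    rw [Nat.Iio_eq_range, Finset.sum_range]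
    refine Finset.sum_congr rfl fun k _ => ?_
    rw [← ih k k.2, Submodule.starProjection_singleton, ← smul_eq_C_mul, map_smul,
      inner_polyToL2]
    congr 2
    rw [RCLike.ofReal_pow, ← inner_self_eq_norm_sq_to_K, inner_polyToL2]

lemma polyToL2_orthoPoly (hc : IsCompact μ.support) (n : ℕ) :
    polyToL2 hc (orthoPoly μ n) =
      InnerProductSpace.gramSchmidtNormed ℂ (fun n : ℕ => polyToL2 hc (X ^ n)) n := by
  rw [InnerProductSpace.gramSchmidtNormed, ← polyToL2_monicOrthoPoly, norm_polyToL2, orthoPoly,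
    ← smul_eq_C_mul, map_smul]
  simp

/-- `φ_n(·; μ)` as an element of `𝒫`. -/
def orthoVec (hc : IsCompact μ.support) (n : ℕ) : polySpace hc :=
  ⟨polyToL2 hc (orthoPoly μ n), Submodule.le_topologicalClosure _ ⟨_, rfl⟩⟩

lemma orthonormal_orthoPoly (hc : IsCompact μ.support) (hi : μ.support.Infinite) :
    Orthonormal ℂ fun n : ℕ => polyToL2 hc (orthoPoly μ n) := by
  simp_rw [polyToL2_orthoPoly]
  exact InnerProductSpace.gramSchmidtNormed_orthonormal (linearIndependent_monomials hc hi)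

lemma orthonormal_orthoVec (hc : IsCompact μ.support) (hi : μ.support.Infinite) :
    Orthonormal ℂ (orthoVec hc) :=
  (orthonormal_orthoPoly hc hi).codRestrict _ _

lemma range_polyToL2_eq_span (hc : IsCompact μ.support) :
    LinearMap.range (polyToL2 hc) =
      Submodule.span ℂ (Set.range fun n : ℕ => polyToL2 hc (orthoPoly μ n)) := by
  simp_rw [polyToL2_orthoPoly]
  rw [InnerProductSpace.span_gramSchmidtNormed_range, InnerProductSpace.span_gramSchmidt,
    LinearMap.range_eq_map, ← (basisMonomials ℂ).span_eq, Submodule.map_span, ← Set.range_comp]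
  congr 2
  funext n
  simp [monomial_one_right_eq_X_pow]

lemma dense_span_orthoVec (hc : IsCompact μ.support) :
    ⊤ ≤ (Submodule.span ℂ (Set.range (orthoVec hc))).topologicalClosure := by
  rintro ⟨f, hf⟩ -
  refine closure_subtype.2 ?_
  have h : (Submodule.span ℂ (Set.range (orthoVec hc))).map (polySpace hc).subtype =
      LinearMap.range (polyToL2 hc) := by
    rw [range_polyToL2_eq_span, Submodule.map_span, ← Set.range_comp]
    rfl
  have h' : (((↑) : polySpace hc → Lp ℂ 2 μ) ''
      (Submodule.span ℂ (Set.range (orthoVec hc)) : Set (polySpace hc))) =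
      (LinearMap.range (polyToL2 hc) : Set (Lp ℂ 2 μ)) := by
    rw [← h]; rfl
  exact h'.symm ▸ hf

/-- The orthonormal basis `{φ_n}` of `𝒫`. -/
def orthoBasis (hc : IsCompact μ.support) (hi : μ.support.Infinite) :
    HilbertBasis ℕ ℂ (polySpace hc) :=
  HilbertBasis.mk (orthonormal_orthoVec hc hi) (dense_span_orthoVec hc)

/-- The Bergman shift matrix `M` as a bounded operator on `ℓ²(ℕ)`: multiplication by `z` on `𝒫`,
written in the orthonormal basis `{φ_n}`. -/
def shiftMatrix (hc : IsCompact μ.support) (hi : μ.support.Infinite) :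
    ℓ²(ℕ, ℂ) →L[ℂ] ℓ²(ℕ, ℂ) :=
  ((orthoBasis hc hi).repr.toContinuousLinearEquiv : polySpace hc →L[ℂ] ℓ²(ℕ, ℂ)) ∘L
    mulZPoly hc ∘L
    ((orthoBasis hc hi).repr.symm.toContinuousLinearEquiv : ℓ²(ℕ, ℂ) →L[ℂ] polySpace hc)

/-- The entries of `M` are `⟨z φ_k, φ_j⟩` (indices starting at `0`). -/
lemma shiftMatrix_entry (hc : IsCompact μ.support) (hi : μ.support.Infinite) (j k : ℕ) :
    shiftMatrix hc hi (lp.single 2 k (1 : ℂ)) j =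
      ∫ z, z * (orthoPoly μ k).eval z * conj ((orthoPoly μ j).eval z) ∂μ := by
  have h : shiftMatrix hc hi (lp.single 2 k (1 : ℂ)) j =
      ⟪polyToL2 hc (orthoPoly μ j), mulZ hc (polyToL2 hc (orthoPoly μ k))⟫_ℂ := by
    change (orthoBasis hc hi).repr (mulZPoly hc
      ((orthoBasis hc hi).repr.symm (lp.single 2 k (1 : ℂ)))) j = _
    rw [HilbertBasis.repr_symm_single, HilbertBasis.repr_apply_apply, orthoBasis,
      HilbertBasis.coe_mk]
    rfl
  rw [h, mulZ_polyToL2, inner_polyToL2, polyInner]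
  simp [mul_comm]

lemma leadingCoeff_orthoPoly (ν : Measure ℂ) (n : ℕ) :
    (orthoPoly ν n).leadingCoeff = (kappa ν n : ℂ) := by
  rw [kappa, orthoPoly, leadingCoeff_mul, leadingCoeff_C,
    (monic_natDegree_monicOrthoPoly ν n).1.leadingCoeff, mul_one, Complex.ofReal_re]

lemma kappa_pos (hc : IsCompact μ.support) (hi : μ.support.Infinite) (n : ℕ) :
    0 < kappa μ n := by
  rw [kappa, orthoPoly, leadingCoeff_mul, leadingCoeff_C,
    (monic_natDegree_monicOrthoPoly μ n).1.leadingCoeff, mul_one, Complex.ofReal_re, inv_pos,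
    ← norm_polyToL2 hc, norm_pos_iff]
  exact fun h => (monic_natDegree_monicOrthoPoly μ n).1.ne_zero
    ((injective_iff_map_eq_zero _).1 (polyToL2_injective hc hi) _ h)

end Space

/-! ### The right shift on `ℓ²(ℕ)` -/

/-- The sequence `(0, x_0, x_1, …)`. -/
def shiftSeq (x : ℕ → ℂ) : ℕ → ℂ
  | 0 => 0
  | n + 1 => x n

lemma hasSum_shiftSeq (x : ℓ²(ℕ, ℂ)) :
    HasSum (fun n : ℕ => ‖shiftSeq x n‖ ^ (2 : ℝ≥0∞).toReal) (‖x‖ ^ (2 : ℝ≥0∞).toReal) := by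
  rw [← hasSum_nat_add_iff' 1]
  simpa [shiftSeq] using lp.hasSum_norm (p := 2) (by simp) x

/-- The right shift `ℛ` on `ℓ²(ℕ)` as a linear map. -/
def rightShiftLin : ℓ²(ℕ, ℂ) →ₗ[ℂ] ℓ²(ℕ, ℂ) where
  toFun x := ⟨shiftSeq x, memℓp_gen (hasSum_shiftSeq x).summable⟩
  map_add' x y := by
    apply lp.ext
    funext n
    cases n
    · exact (add_zero (0 : ℂ)).symm
    · rfl
  map_smul' c x := by
    apply lp.ext
    funext n
    cases n
    · exact (mul_zero c).symm
    · rfl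

/-- The right shift operator `ℛ : (x_0, x_1, …) ↦ (0, x_0, x_1, …)` on `ℓ²(ℕ)`. -/
def rightShift : ℓ²(ℕ, ℂ) →L[ℂ] ℓ²(ℕ, ℂ) :=
  rightShiftLin.mkContinuous 1 fun x => by
    rw [one_mul]
    refine lp.norm_le_of_tsum_le (p := 2) (by simp) (norm_nonneg x) ?_
    exact (hasSum_shiftSeq x).tsum_eq.le

lemma rightShift_zero (x : ℓ²(ℕ, ℂ)) : rightShift x 0 = 0 := rfl

lemma rightShift_succ (x : ℓ²(ℕ, ℂ)) (n : ℕ) : rightShift x (n + 1) = x n := rfl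

end Bergman

end

/-!
Write `ν = |P|² μ`, `φ_n = φ_n(·; μ)` and `κ_n = κ_n(μ)`. Since `P` is monic,
`⟨φ_{n+q}, P φ_n⟩ = κ_n / κ_{n+q}`, while `‖P φ_n‖ ≤ r` because `|P| ≤ r` almost everywhere. So
`κ_n / κ_{n+q} ≤ r` and `‖P φ_n - r φ_{n+q}‖² ≤ 2 r² - 2 r κ_n / κ_{n+q}`. In the basis `φ_n` the
left side is `‖(P(M) - r ℛ^q) e_n‖²`, and as the `ℛⁿ` are isometries, strong convergence only has
to be tested on the standard basis (`tendsto_mul_rightShift_pow`). Everything therefore reduces to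
`liminf κ_n / κ_{n+q} ≥ r` (`tendsto_kappa_div_kappa`), where
`κ_n / κ_{n+q} = (κ_n(ν) / κ_{n+q}) / (κ_n(ν) / κ_n)`.

* The denominator is at most `‖φ_n(ν)‖` in `L²(μ)`. As `∑ |φ_n(ν)|²` is bounded on
  `{|P| ≤ s}` for `s < r`, the integral of `|φ_n(ν)|²` over that set tends to `0`; off that set
  `|φ_n(ν)|² ≤ s⁻² |P φ_n(ν)|²`, and `P φ_n(ν)` is a unit vector of `L²(μ)`. Hence the `limsup` of
  the denominator is at most `1 / r` (`norm_sq_orthoPoly_sqAbsMeasure_le`).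

* The numerator is `b = ⟨φ_{n+q}, P φ_n(ν)⟩`. The difference `R = P φ_n(ν) - b φ_{n+q}` has degree
  less than `n + q` and is orthogonal to all `P g` with `deg g < n`, so that
  `‖R‖² = ⟨R, R mod P⟩ = -b ⟨R, φ_{n+q} mod P⟩`. This gives `1 - b² ≤ ‖φ_{n+q} mod P‖²`
  (`one_sub_sq_kappa_div_le`), and it remains to see that `φ_m mod P → 0`. The inequality
  `‖P f‖ ≤ r ‖f‖` carries the bound on the Christoffel kernel from `ν` over to `μ`
  (`sum_norm_orthoPoly_sq_le`); so `∑ |φ_m|²` is bounded near the zeros of `P`, and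
  `LocallySquareBounded.tendsto_modByMonic` applies.
-/

namespace Bergman

/-! ### Orthogonality relations and the Christoffel kernel -/

section Christoffel

variable {μ : Measure ℂ} [IsFiniteMeasure μ]

lemma natDegree_orthoPoly_le (ν : Measure ℂ) (n : ℕ) : (orthoPoly ν n).natDegree ≤ n := by
  rw [orthoPoly]
  exact (natDegree_C_mul_le _ _).trans (monic_natDegree_monicOrthoPoly ν n).2.le

lemma coeff_orthoPoly_self (ν : Measure ℂ) (n : ℕ) : (orthoPoly ν n).coeff n = (kappa ν n : ℂ) := by
  have h := monic_natDegree_monicOrthoPoly ν n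
  have h1 : (monicOrthoPoly ν n).coeff n = 1 := by
    have := h.1.coeff_natDegree
    rwa [h.2] at this
  rw [← leadingCoeff_orthoPoly, orthoPoly, coeff_C_mul, leadingCoeff_mul, leadingCoeff_C,
    h.1.leadingCoeff, h1]

lemma norm_polyToL2_orthoPoly (hc : IsCompact μ.support) (hi : μ.support.Infinite) (n : ℕ) :
    ‖polyToL2 hc (orthoPoly μ n)‖ = 1 :=
  (orthonormal_orthoPoly hc hi).1 n

lemma inner_orthoPoly_X_pow_of_lt (hc : IsCompact μ.support) {i n : ℕ} (h : i < n) :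
    ⟪polyToL2 hc (orthoPoly μ n), polyToL2 hc (X ^ i)⟫_ℂ = 0 := by
  rw [polyToL2_orthoPoly, InnerProductSpace.gramSchmidtNormed, inner_smul_left,
    InnerProductSpace.gramSchmidt_inv_triangular ℂ (fun n : ℕ => polyToL2 hc (X ^ n)) h, mul_zero]

/-- Pairing with `φ_n` reads off the coefficient of `zⁿ` of a polynomial of degree at most `n`. -/
lemma inner_orthoPoly_eq_coeff_div (hc : IsCompact μ.support) (hi : μ.support.Infinite) {n : ℕ}
    {f : ℂ[X]} (hf : f.natDegree ≤ n) :
    ⟪polyToL2 hc (orthoPoly μ n), polyToL2 hc f⟫_ℂ = f.coeff n / kappa μ n := by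
  have key : ∀ g : ℂ[X], g.natDegree ≤ n →
      ⟪polyToL2 hc (orthoPoly μ n), polyToL2 hc g⟫_ℂ =
        g.coeff n * ⟪polyToL2 hc (orthoPoly μ n), polyToL2 hc (X ^ n)⟫_ℂ := by
    intro g hg
    conv_lhs => rw [g.as_sum_range_C_mul_X_pow' (Nat.lt_succ_of_le hg)]
    rw [map_sum, inner_sum, Finset.sum_range_succ, Finset.sum_eq_zero, zero_add, ← smul_eq_C_mul,
      map_smul, inner_smul_right]
    intro i hi'
    rw [← smul_eq_C_mul, map_smul, inner_smul_right,
      inner_orthoPoly_X_pow_of_lt hc (Finset.mem_range.1 hi'), mul_zero]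
  have h1 := key _ (natDegree_orthoPoly_le μ n)
  have hk : (kappa μ n : ℂ) ≠ 0 := Complex.ofReal_ne_zero.2 (kappa_pos hc hi n).ne'
  rw [inner_self_eq_norm_sq_to_K, norm_polyToL2_orthoPoly hc hi, coeff_orthoPoly_self] at h1
  rw [key f hf, div_eq_mul_inv]
  congr 1
  refine eq_inv_of_mul_eq_one_right ?_
  rw [← h1]
  simp

lemma inner_orthoPoly_of_degree_lt (hc : IsCompact μ.support) (hi : μ.support.Infinite) {n : ℕ}
    {f : ℂ[X]} (hf : f.degree < n) :
    ⟪polyToL2 hc (orthoPoly μ n), polyToL2 hc f⟫_ℂ = 0 := by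
  rw [inner_orthoPoly_eq_coeff_div hc hi (natDegree_le_of_degree_le hf.le),
    coeff_eq_zero_of_degree_lt hf, zero_div]

lemma eq_sum_inner_orthoPoly (hc : IsCompact μ.support) (hi : μ.support.Infinite) (N : ℕ) :
    ∀ f : ℂ[X], f.degree < N → f = ∑ n ∈ Finset.range N,
      ⟪polyToL2 hc (orthoPoly μ n), polyToL2 hc f⟫_ℂ • orthoPoly μ n := by
  induction N with
  | zero =>
    intro f hf
    simpa [Nat.WithBot.lt_zero_iff] using hf
  | succ N ih =>
    intro f hf
    have hfN : f.natDegree ≤ N := natDegree_le_iff_coeff_eq_zero.2 fun m hm =>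
      (degree_lt_iff_coeff_zero f (N + 1)).1 hf m hm
    have hk : (kappa μ N : ℂ) ≠ 0 := Complex.ofReal_ne_zero.2 (kappa_pos hc hi N).ne'
    set c := ⟪polyToL2 hc (orthoPoly μ N), polyToL2 hc f⟫_ℂ with hcdef
    have hg : (f - c • orthoPoly μ N).degree < N := by
      rw [degree_lt_iff_coeff_zero]
      intro m hm
      rcases hm.eq_or_lt with rfl | hm
      · rw [coeff_sub, coeff_smul, coeff_orthoPoly_self, hcdef,
          inner_orthoPoly_eq_coeff_div hc hi hfN, smul_eq_mul, div_mul_cancel₀ _ hk, sub_self]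
      · rw [coeff_sub, coeff_smul, coeff_eq_zero_of_natDegree_lt (hfN.trans_lt hm),
          coeff_eq_zero_of_natDegree_lt ((natDegree_orthoPoly_le μ N).trans_lt hm), smul_zero,
          sub_zero]
    have h := ih _ hg
    rw [Finset.sum_range_succ, ← sub_eq_iff_eq_add]
    refine h.trans (Finset.sum_congr rfl fun n hn => ?_)
    rw [map_sub, map_smul, inner_sub_right, inner_smul_right,
      (orthonormal_orthoPoly hc hi).2 (Finset.mem_range.1 hn).ne, mul_zero, sub_zero]

/-- The extremal property of the Christoffel kernel `∑_{n < N} |φ_n(z)|²`. -/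
lemma norm_eval_sq_le (hc : IsCompact μ.support) (hi : μ.support.Infinite) {N : ℕ} {f : ℂ[X]}
    (hf : f.degree < N) (z : ℂ) :
    ‖f.eval z‖ ^ 2 ≤
      (∑ n ∈ Finset.range N, ‖(orthoPoly μ n).eval z‖ ^ 2) * ‖polyToL2 hc f‖ ^ 2 := by
  have h1 : ‖f.eval z‖ ≤ ∑ n ∈ Finset.range N, ‖(orthoPoly μ n).eval z‖ *
      ‖⟪polyToL2 hc (orthoPoly μ n), polyToL2 hc f⟫_ℂ‖ := by
    conv_lhs => rw [eq_sum_inner_orthoPoly hc hi N f hf]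
    rw [eval_finsetSum]
    refine (norm_sum_le _ _).trans (Finset.sum_le_sum fun n _ => ?_)
    rw [eval_smul, norm_smul, mul_comm]
  calc ‖f.eval z‖ ^ 2 ≤ _ := pow_le_pow_left₀ (norm_nonneg _) h1 2
    _ ≤ _ := Finset.sum_mul_sq_le_sq_mul_sq _ _ _
    _ ≤ _ := by
      gcongr
      exact (orthonormal_orthoPoly hc hi).sum_inner_products_le _

/-- The Christoffel kernel as the square norm of the polynomial `∑ conj (φ_n(z)) φ_n`. -/
lemma norm_sq_kernelPoly (hc : IsCompact μ.support) (hi : μ.support.Infinite) (N : ℕ) (z : ℂ) :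
    ‖polyToL2 hc (∑ n ∈ Finset.range N, conj ((orthoPoly μ n).eval z) • orthoPoly μ n)‖ ^ 2 =
      ∑ n ∈ Finset.range N, ‖(orthoPoly μ n).eval z‖ ^ 2 := by
  have h := (orthonormal_orthoPoly hc hi).inner_sum (fun n => conj ((orthoPoly μ n).eval z))
    (fun n => conj ((orthoPoly μ n).eval z)) (Finset.range N)
  simp_rw [map_sum, map_smul]
  have h2 := inner_self_eq_norm_sq_to_K (𝕜 := ℂ)
    (∑ n ∈ Finset.range N, conj ((orthoPoly μ n).eval z) • polyToL2 hc (orthoPoly μ n))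
  rw [h] at h2
  have h3 : ((∑ n ∈ Finset.range N, ‖(orthoPoly μ n).eval z‖ ^ 2 : ℝ) : ℂ) =
      ((‖∑ n ∈ Finset.range N, conj ((orthoPoly μ n).eval z) •
        polyToL2 hc (orthoPoly μ n)‖ ^ 2 : ℝ) : ℂ) := by
    push_cast
    refine Eq.trans (Finset.sum_congr rfl fun n _ => ?_) h2
    simp [Complex.mul_conj']
  exact (Complex.ofReal_injective h3).symm

end Christoffel

/-! ### The measure `|P|² μ` -/

section Density

variable {μ : Measure ℂ}

lemma measurable_enorm_eval_sq (P : ℂ[X]) : Measurable fun z : ℂ => ‖P.eval z‖ₑ ^ 2 :=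
  P.continuous.measurable.enorm.pow_const 2

lemma isCompact_support_sqAbsMeasure (P : ℂ[X]) (hc : IsCompact μ.support) :
    IsCompact (sqAbsMeasure P μ).support :=
  hc.of_isClosed_subset Measure.isClosed_support (withDensity_absolutelyContinuous _ _).support_mono

lemma infinite_support_sqAbsMeasure {P : ℂ[X]} (hP : P ≠ 0) (hi : μ.support.Infinite) :
    (sqAbsMeasure P μ).support.Infinite := by
  intro hfin
  have h0 : ∀ᵐ z ∂sqAbsMeasure P μ, z ∈ (sqAbsMeasure P μ).support := Measure.support_mem_ae
  -- `μ` lives on the support of `|P|² μ` together with the zeros of `P`.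
  have h1 : ∀ᵐ z ∂μ, z ∈ (sqAbsMeasure P μ).support ∪ P.rootSet ℂ := by
    filter_upwards [(ae_withDensity_iff (measurable_enorm_eval_sq P)).1 h0] with z hz
    by_cases hPz : P.eval z = 0
    · exact Or.inr ((mem_rootSet.2 ⟨hP, by simpa using hPz⟩))
    · exact Or.inl (hz (by simpa using hPz))
  have hfin' := hfin.union (P.rootSet_finite ℂ)
  exact hi (hfin'.subset (Measure.support_subset_of_isClosed hfin'.isClosed h1))

lemma polyInner_sqAbsMeasure (P f g : ℂ[X]) :
    polyInner (sqAbsMeasure P μ) f g = polyInner μ (P * f) (P * g) := by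
  rw [polyInner, polyInner, sqAbsMeasure,
    integral_withDensity_eq_integral_toReal_smul (measurable_enorm_eval_sq P)
      (Eventually.of_forall fun z => by simp)]
  refine integral_congr_ae (Eventually.of_forall fun z => ?_)
  simp only [ENNReal.toReal_pow, toReal_enorm, eval_mul, map_mul, Complex.real_smul]
  push_cast
  rw [← Complex.conj_mul']
  ring

variable [IsFiniteMeasure μ]

lemma isFiniteMeasure_sqAbsMeasure (P : ℂ[X]) (hc : IsCompact μ.support) :
    IsFiniteMeasure (sqAbsMeasure P μ) := by
  refine isFiniteMeasure_withDensity ?_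
  have h := (memLp_poly hc P).eLpNorm_lt_top
  rw [eLpNorm_lt_top_iff_lintegral_rpow_enorm_lt_top (by simp) (by simp)] at h
  refine ne_of_lt ?_
  simpa using h

lemma inner_polyToL2_sqAbsMeasure (P : ℂ[X]) [IsFiniteMeasure (sqAbsMeasure P μ)]
    (hc : IsCompact μ.support) (hc' : IsCompact (sqAbsMeasure P μ).support) (f g : ℂ[X]) :
    ⟪polyToL2 hc' f, polyToL2 hc' g⟫_ℂ = ⟪polyToL2 hc (P * f), polyToL2 hc (P * g)⟫_ℂ := by
  rw [inner_polyToL2, inner_polyToL2, polyInner_sqAbsMeasure]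

lemma norm_polyToL2_sqAbsMeasure (P : ℂ[X]) [IsFiniteMeasure (sqAbsMeasure P μ)]
    (hc : IsCompact μ.support) (hc' : IsCompact (sqAbsMeasure P μ).support) (f : ℂ[X]) :
    ‖polyToL2 hc' f‖ = ‖polyToL2 hc (P * f)‖ := by
  rw [@norm_eq_sqrt_re_inner ℂ, @norm_eq_sqrt_re_inner ℂ, inner_polyToL2_sqAbsMeasure P hc hc']

lemma norm_polyToL2_mul_le {P : ℂ[X]} {r : ℝ} (hc : IsCompact μ.support)
    (hμ : ∀ᵐ z ∂μ, ‖P.eval z‖ ≤ r) (f : ℂ[X]) :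
    ‖polyToL2 hc (P * f)‖ ≤ r * ‖polyToL2 hc f‖ := by
  refine Lp.norm_le_mul_norm_of_ae_le_mul ?_
  filter_upwards [hμ, (memLp_poly hc (P * f)).coeFn_toLp, (memLp_poly hc f).coeFn_toLp]
    with z h1 h2 h3
  change ‖((memLp_poly hc (P * f)).toLp _ : ℂ → ℂ) z‖ ≤
    r * ‖((memLp_poly hc f).toLp _ : ℂ → ℂ) z‖
  rw [h2, h3, eval_mul, norm_mul]
  gcongr

/-- Since `‖P f‖ ≤ r ‖f‖`, point evaluations that are bounded for `|P|² μ` are bounded for `μ`: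
this compares the Christoffel kernels of the two measures. -/
lemma sum_norm_orthoPoly_sq_le (P : ℂ[X]) {r : ℝ} [IsFiniteMeasure (sqAbsMeasure P μ)]
    (hc : IsCompact μ.support) (hi : μ.support.Infinite)
    (hc' : IsCompact (sqAbsMeasure P μ).support) (hi' : (sqAbsMeasure P μ).support.Infinite)
    (hμ : ∀ᵐ z ∂μ, ‖P.eval z‖ ≤ r) (N : ℕ) (z : ℂ) :
    ∑ n ∈ Finset.range N, ‖(orthoPoly μ n).eval z‖ ^ 2 ≤
      r ^ 2 * ∑ n ∈ Finset.range N, ‖(orthoPoly (sqAbsMeasure P μ) n).eval z‖ ^ 2 := by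
  set S := ∑ n ∈ Finset.range N, ‖(orthoPoly μ n).eval z‖ ^ 2 with hS
  set S' := ∑ n ∈ Finset.range N, ‖(orthoPoly (sqAbsMeasure P μ) n).eval z‖ ^ 2 with hS'
  set f := ∑ n ∈ Finset.range N, conj ((orthoPoly μ n).eval z) • orthoPoly μ n with hf
  have hS0 : 0 ≤ S := Finset.sum_nonneg fun _ _ => by positivity
  have hS0' : 0 ≤ S' := Finset.sum_nonneg fun _ _ => by positivity
  have hdeg : f.degree < N := by
    refine lt_of_le_of_lt (degree_sum_le _ _) ((Finset.sup_lt_iff (WithBot.bot_lt_coe N)).2 ?_)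
    intro n hn
    refine (degree_smul_le _ _).trans_lt (degree_le_natDegree.trans_lt ?_)
    exact WithBot.coe_lt_coe.2
      ((natDegree_orthoPoly_le μ n).trans_lt (Finset.mem_range.1 hn))
  have heval : f.eval z = (S : ℂ) := by
    rw [hf, hS, eval_finsetSum]
    push_cast
    refine Finset.sum_congr rfl fun n _ => ?_
    rw [eval_smul, smul_eq_mul, Complex.conj_mul']
  have h1 := norm_eval_sq_le hc' hi' hdeg z
  rw [heval, Complex.norm_real, Real.norm_of_nonneg hS0, norm_polyToL2_sqAbsMeasure P hc hc'] at h1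
  have h2 : ‖polyToL2 hc (P * f)‖ ^ 2 ≤ r ^ 2 * S := by
    rw [hS, ← norm_sq_kernelPoly hc hi N z, ← mul_pow]
    exact pow_le_pow_left₀ (norm_nonneg _) (norm_polyToL2_mul_le hc hμ f) 2
  rcases hS0.eq_or_lt with h0 | h0
  · rw [← h0]
    positivity
  · refine le_of_mul_le_mul_right ?_ h0
    nlinarith [mul_le_mul_of_nonneg_left h2 hS0']

end Density

/-! ### Remainders modulo `P` of locally square-summable sequences of polynomials -/

section Remainder

/-- The sums `∑_n |f_n|²` are bounded near each point of `U`. They are encoded by their partial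
sums, so that no summability has to be carried along. -/
def LocallySquareBounded (U : Set ℂ) (f : ℕ → ℂ[X]) : Prop :=
  ∀ z₀ ∈ U, ∃ ε > 0, ∃ C : ℝ, ∀ z ∈ Metric.closedBall z₀ ε, ∀ N : ℕ,
    ∑ n ∈ Finset.range N, ‖(f n).eval z‖ ^ 2 ≤ C

lemma LocallySquareBounded.tendsto_eval {U : Set ℂ} {f : ℕ → ℂ[X]}
    (hf : LocallySquareBounded U f) {a : ℂ} (ha : a ∈ U) :
    Tendsto (fun n => (f n).eval a) atTop (𝓝 0) := by
  obtain ⟨ε, hε, C, hC⟩ := hf a ha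
  have hs := summable_of_sum_range_le (fun n => sq_nonneg ‖(f n).eval a‖)
    (hC a (Metric.mem_closedBall_self hε.le))
  have h := hs.tendsto_atTop_zero.sqrt
  simp only [Real.sqrt_sq (norm_nonneg _), Real.sqrt_zero] at h
  exact tendsto_zero_iff_norm_tendsto_zero.2 h

/-- Dividing by `X - a` preserves local square-boundedness: the quotients are controlled on small
circles avoiding `a`, hence inside them by the maximum principle for the vector-valued function
`(f_0 /ₘ (X - a), …, f_{N-1} /ₘ (X - a))`. -/
lemma LocallySquareBounded.divByMonic {U : Set ℂ} {f : ℕ → ℂ[X]}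
    (hf : LocallySquareBounded U f) {a : ℂ} (ha : a ∈ U) :
    LocallySquareBounded U fun n => f n /ₘ (X - C a) := by
  intro z₀ hz₀
  obtain ⟨ε₁, hε₁, C₁, hC₁⟩ := hf z₀ hz₀
  obtain ⟨ε₂, hε₂, C₂, hC₂⟩ := hf a ha
  -- The circle of radius `ε` about `z₀` has distance at least `ε` from `a`, also if `a = z₀`.
  obtain ⟨ε, hε, hεle, hdist⟩ : ∃ ε > 0, ε ≤ ε₁ ∧ ∀ z, dist z z₀ = ε → ε ≤ ‖z - a‖ := by
    by_cases h : z₀ = a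
    · refine ⟨ε₁, hε₁, le_rfl, fun z hz => ?_⟩
      rw [← hz, h, dist_eq_norm]
    · have hd : 0 < dist z₀ a := dist_pos.2 h
      refine ⟨min ε₁ (dist z₀ a / 2), lt_min hε₁ (half_pos hd), min_le_left _ _, fun z hz => ?_⟩
      have h1 := dist_triangle z₀ z a
      have h2 := min_le_right ε₁ (dist z₀ a / 2)
      rw [dist_comm z₀ z, hz] at h1
      rw [← dist_eq_norm]
      linarith
  refine ⟨ε, hε, 2 * (C₁ + C₂) / ε ^ 2, fun w hw N => ?_⟩
  have hC0 : 0 ≤ 2 * (C₁ + C₂) / ε ^ 2 := by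
    have h1 := hC₁ z₀ (Metric.mem_closedBall_self hε₁.le) 0
    have h2 := hC₂ a (Metric.mem_closedBall_self hε₂.le) 0
    rw [Finset.sum_range_zero] at h1 h2
    positivity
  set F : ℂ → EuclideanSpace ℂ (Fin N) := fun z =>
    WithLp.toLp 2 fun n : Fin N => (f n /ₘ (X - C a)).eval z with hF
  have hFsq : ∀ z, ‖F z‖ ^ 2 = ∑ n ∈ Finset.range N, ‖(f n /ₘ (X - C a)).eval z‖ ^ 2 := by
    intro z
    rw [EuclideanSpace.norm_sq_eq, Finset.sum_range]
  have hdiff : Differentiable ℂ F := by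
    rw [differentiable_euclidean]
    exact fun n => Polynomial.differentiable _
  rw [← hFsq]
  refine (Real.le_sqrt (norm_nonneg _) hC0).1 ?_
  refine Complex.norm_le_of_forall_mem_frontier_norm_le (U := Metric.ball z₀ ε)
    Metric.isBounded_ball hdiff.diffContOnCl (fun z hz => ?_)
    (by rwa [closure_ball _ hε.ne'])
  rw [frontier_ball _ hε.ne', Metric.mem_sphere] at hz
  refine (Real.le_sqrt (norm_nonneg _) hC0).2 ?_
  rw [hFsq, le_div_iff₀ (by positivity), Finset.sum_mul]
  have hterm : ∀ n ∈ Finset.range N, ‖(f n /ₘ (X - C a)).eval z‖ ^ 2 * ε ^ 2 ≤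
      2 * (‖(f n).eval z‖ ^ 2 + ‖(f n).eval a‖ ^ 2) := by
    intro n _
    have h1 : (z - a) * (f n /ₘ (X - C a)).eval z = (f n).eval z - (f n).eval a := by
      have := congrArg (eval z) (X_sub_C_mul_divByMonic_eq_sub_modByMonic (f n) a)
      simpa [modByMonic_X_sub_C_eq_C_eval] using this
    calc ‖(f n /ₘ (X - C a)).eval z‖ ^ 2 * ε ^ 2
        ≤ ‖(f n /ₘ (X - C a)).eval z‖ ^ 2 * ‖z - a‖ ^ 2 := by
          gcongr
          exact hdist z hz
      _ = ‖(f n).eval z - (f n).eval a‖ ^ 2 := by rw [← h1, norm_mul]; ring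
      _ ≤ (‖(f n).eval z‖ + ‖(f n).eval a‖) ^ 2 :=
          pow_le_pow_left₀ (norm_nonneg _) (norm_sub_le _ _) 2
      _ ≤ _ := by nlinarith [sq_nonneg (‖(f n).eval z‖ - ‖(f n).eval a‖)]
  refine (Finset.sum_le_sum hterm).trans ?_
  rw [← Finset.mul_sum, Finset.sum_add_distrib]
  have h1 := hC₁ z (Metric.mem_closedBall.2 (hz.le.trans hεle)) N
  have h2 := hC₂ a (Metric.mem_closedBall_self hε₂.le) N
  linarith

lemma modByMonic_X_sub_C_mul (f : ℂ[X]) (a : ℂ) {Q : ℂ[X]} (hQ : Q.Monic) :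
    f %ₘ ((X - C a) * Q) = C (f.eval a) + (X - C a) * ((f /ₘ (X - C a)) %ₘ Q) := by
  refine (div_modByMonic_unique ((f /ₘ (X - C a)) /ₘ Q) _ ((monic_X_sub_C a).mul hQ) ⟨?_, ?_⟩).2
  · have h1 := modByMonic_add_div (f /ₘ (X - C a)) Q
    have h2 := modByMonic_add_div f (X - C a)
    rw [modByMonic_X_sub_C_eq_C_eval] at h2
    linear_combination (X - C a) * h1 + h2
  · have hd : ((X - C a) * Q).degree = 1 + Q.degree := by rw [degree_mul, degree_X_sub_C]
    rw [hd]
    have hQ0 : (0 : WithBot ℕ) ≤ Q.degree := zero_le_degree_iff.2 hQ.ne_zero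
    refine (degree_add_le _ _).trans_lt (max_lt ?_ ?_)
    · refine degree_C_le.trans_lt ?_
      rw [degree_eq_natDegree hQ.ne_zero]
      exact_mod_cast (by omega : 0 < 1 + Q.natDegree)
    · rw [degree_mul, degree_X_sub_C]
      exact WithBot.add_lt_add_left (by simp) (degree_modByMonic_lt _ hQ)

variable {μ : Measure ℂ} [IsFiniteMeasure μ]

/-- If `∑ |f_n|²` is locally bounded near the zeros of `P`, then `f_n` tends to `0` modulo `P`.
Multiple zeros are handled by dividing out one linear factor at a time. -/
lemma LocallySquareBounded.tendsto_modByMonic (hc : IsCompact μ.support) {U : Set ℂ}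
    {P : ℂ[X]} (hP : P.Monic) (hroots : ∀ a ∈ P.roots, a ∈ U) {f : ℕ → ℂ[X]}
    (hf : LocallySquareBounded U f) :
    Tendsto (fun n => polyToL2 hc (f n %ₘ P)) atTop (𝓝 0) := by
  have key : ∀ (s : Multiset ℂ), (∀ a ∈ s, a ∈ U) → ∀ f : ℕ → ℂ[X], LocallySquareBounded U f →
      Tendsto (fun n => polyToL2 hc (f n %ₘ (s.map fun a => X - C a).prod)) atTop (𝓝 0) := by
    intro s
    induction s using Multiset.induction_on with
    | empty =>
      intro _ f _
      simp
    | cons a s ih =>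
      intro hs f hf
      have ha := hs a (Multiset.mem_cons_self a s)
      have h1 := ih (fun b hb => hs b (Multiset.mem_cons_of_mem hb)) _ (hf.divByMonic ha)
      have hmonic : (s.map fun a => X - C a).prod.Monic :=
        monic_multiset_prod_of_monic _ _ fun b _ => monic_X_sub_C b
      have h2 := ((hf.tendsto_eval ha).smul_const (polyToL2 hc 1)).add
        ((((mulZ hc).continuous.tendsto 0).comp h1).sub (h1.const_smul a))
      simp only [map_zero, smul_zero, zero_smul, sub_zero, add_zero] at h2
      refine h2.congr fun n => ?_
      rw [Multiset.map_cons, Multiset.prod_cons, modByMonic_X_sub_C_mul _ _ hmonic, sub_mul,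
        map_add, map_sub, ← mulZ_polyToL2, ← smul_eq_C_mul, map_smul, ← mul_one (C (eval a (f n))),
        ← smul_eq_C_mul, map_smul]
      rfl
  have hsplit := (IsAlgClosed.splits P).eq_prod_roots_of_monic hP
  have h := key P.roots hroots f hf
  rwa [← hsplit] at h

end Remainder
/-! ### Asymptotics of the leading coefficients -/

section LeadingCoefficients

variable {μ : Measure ℂ} [IsFiniteMeasure μ]

/-- `κ_n(μ) / κ_{n+q}(μ)` is the coefficient of `φ_{n+q}` in `P φ_n`; more generally, `φ_n` may
belong to another measure. -/
lemma inner_orthoPoly_mul_orthoPoly {P : ℂ[X]} (hP : P.Monic) (hc : IsCompact μ.support)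
    (hi : μ.support.Infinite) (ν : Measure ℂ) (n : ℕ) :
    ⟪polyToL2 hc (orthoPoly μ (n + P.natDegree)), polyToL2 hc (P * orthoPoly ν n)⟫_ℂ =
      ((kappa ν n / kappa μ (n + P.natDegree) : ℝ) : ℂ) := by
  have hdeg : (P * orthoPoly ν n).natDegree ≤ n + P.natDegree := by
    refine natDegree_mul_le.trans ?_
    have := natDegree_orthoPoly_le ν n
    omega
  rw [inner_orthoPoly_eq_coeff_div hc hi hdeg, add_comm n,
    coeff_mul_add_eq_of_natDegree_le le_rfl (natDegree_orthoPoly_le ν n), hP.coeff_natDegree,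
    one_mul, coeff_orthoPoly_self, Complex.ofReal_div]

/-- The function `P φ_n(|P|² μ)` is a unit vector of `L²(μ)` orthogonal to all `P g` with
`deg g < n`. Hence the part of it orthogonal to `φ_{n+q}(μ)` only sees `φ_{n+q}(μ)` modulo `P`. -/
lemma one_sub_sq_kappa_div_le {P : ℂ[X]} (hP : P.Monic) [IsFiniteMeasure (sqAbsMeasure P μ)]
    (hc : IsCompact μ.support) (hi : μ.support.Infinite)
    (hc' : IsCompact (sqAbsMeasure P μ).support) (hi' : (sqAbsMeasure P μ).support.Infinite)
    (n : ℕ) :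
    1 - ‖polyToL2 hc (orthoPoly μ (n + P.natDegree) %ₘ P)‖ ^ 2 ≤
      (kappa (sqAbsMeasure P μ) n / kappa μ (n + P.natDegree)) ^ 2 := by
  set ν := sqAbsMeasure P μ with hν
  set b : ℝ := kappa ν n / kappa μ (n + P.natDegree) with hb
  set A := P * orthoPoly ν n with hA
  set B := orthoPoly μ (n + P.natDegree) with hB
  set δ := ‖polyToL2 hc (B %ₘ P)‖ with hδ
  have hBA : ⟪polyToL2 hc B, polyToL2 hc A⟫_ℂ = (b : ℂ) :=
    inner_orthoPoly_mul_orthoPoly hP hc hi ν n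
  have hAn : ‖polyToL2 hc A‖ = 1 := by
    rw [hA, ← norm_polyToL2_sqAbsMeasure P hc hc', norm_polyToL2_orthoPoly hc' hi']
  have hBn : ‖polyToL2 hc B‖ = 1 := norm_polyToL2_orthoPoly hc hi _
  set R := A - (b : ℂ) • B with hR
  have hRn : ‖polyToL2 hc R‖ ^ 2 = 1 - b ^ 2 := by
    have hAB : ⟪polyToL2 hc A, polyToL2 hc B⟫_ℂ = (b : ℂ) := by
      rw [← inner_conj_symm, hBA, Complex.conj_ofReal]
    rw [hR, map_sub, map_smul, @norm_sub_sq ℂ, inner_smul_right, hAB, norm_smul, hAn, hBn,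
      Complex.norm_real, mul_one, Real.norm_eq_abs, sq_abs, ← Complex.ofReal_mul]
    change 1 ^ 2 - 2 * ((b * b : ℝ) : ℂ).re + b ^ 2 = 1 - b ^ 2
    rw [Complex.ofReal_re]
    ring
  have hk : (kappa μ (n + P.natDegree) : ℂ) ≠ 0 :=
    Complex.ofReal_ne_zero.2 (kappa_pos hc hi _).ne'
  have hBR : ⟪polyToL2 hc B, polyToL2 hc R⟫_ℂ = 0 := by
    rw [hR, map_sub, map_smul, inner_sub_right, inner_smul_right, hBA, inner_self_eq_norm_sq_to_K,
      hBn]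
    simp
  have hRdeg : R.degree < ((n + P.natDegree : ℕ) : WithBot ℕ) := by
    have hRle : R.natDegree ≤ n + P.natDegree := by
      refine (natDegree_sub_le _ _).trans (max_le ?_ ?_)
      · refine natDegree_mul_le.trans ?_
        have := natDegree_orthoPoly_le ν n
        omega
      · exact (natDegree_smul_le _ _).trans (natDegree_orthoPoly_le μ _)
    rw [degree_lt_iff_coeff_zero]
    intro m hm
    rcases hm.eq_or_lt with rfl | hm
    · rw [inner_orthoPoly_eq_coeff_div hc hi hRle] at hBR
      simpa [hk] using hBR
    · exact coeff_eq_zero_of_natDegree_lt (hRle.trans_lt hm)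
  have hGdeg : (R /ₘ P).degree < n := by
    rcases lt_or_ge R.degree P.degree with h | h
    · rw [(divByMonic_eq_zero_iff hP).2 h, degree_zero]
      exact WithBot.bot_lt_coe n
    · rw [← degree_add_divByMonic hP h, degree_eq_natDegree hP.ne_zero, Nat.cast_add,
        add_comm] at hRdeg
      exact lt_of_add_lt_add_right hRdeg
  have hPG : (P * (R /ₘ P)).degree < ((n + P.natDegree : ℕ) : WithBot ℕ) := by
    rw [degree_mul, degree_eq_natDegree hP.ne_zero, Nat.cast_add, add_comm]
    exact WithBot.add_lt_add_right (by simp) hGdeg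
  have hRG : ⟪polyToL2 hc R, polyToL2 hc (P * (R /ₘ P))⟫_ℂ = 0 := by
    have h1 : ⟪polyToL2 hc A, polyToL2 hc (P * (R /ₘ P))⟫_ℂ = 0 := by
      rw [hA, ← inner_polyToL2_sqAbsMeasure P hc hc', inner_orthoPoly_of_degree_lt hc' hi' hGdeg]
    have h2 : ⟪polyToL2 hc B, polyToL2 hc (P * (R /ₘ P))⟫_ℂ = 0 :=
      inner_orthoPoly_of_degree_lt hc hi hPG
    have h3 : polyToL2 hc R = polyToL2 hc A - (b : ℂ) • polyToL2 hc B := by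
      rw [hR, map_sub, map_smul]
    rw [h3, inner_sub_left, inner_smul_left, h1, h2, mul_zero, sub_zero]
  have hRmod : R %ₘ P = -((b : ℂ) • (B %ₘ P)) := by
    rw [hR, sub_modByMonic, smul_modByMonic, hA, self_mul_modByMonic hP, zero_sub]
  have h1 : ‖polyToL2 hc R‖ ^ 2 ≤ ‖polyToL2 hc R‖ * (|b| * δ) := by
    have h2 : ⟪polyToL2 hc R, polyToL2 hc R⟫_ℂ =
        ⟪polyToL2 hc R, polyToL2 hc (R %ₘ P)⟫_ℂ := by
      have h3 : polyToL2 hc R = polyToL2 hc (R %ₘ P) + polyToL2 hc (P * (R /ₘ P)) := by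
        rw [← map_add, modByMonic_add_div]
      conv_lhs => rw [h3, inner_add_right, ← h3]
      rw [hRG, add_zero]
    have h4 := norm_inner_le_norm (𝕜 := ℂ) (polyToL2 hc R) (polyToL2 hc (R %ₘ P))
    rw [← h2, inner_self_eq_norm_sq_to_K, hRmod, map_neg, map_smul, norm_neg, norm_smul,
      Complex.norm_real, Real.norm_eq_abs] at h4
    simpa using h4
  have hR0 : 0 ≤ ‖polyToL2 hc R‖ := norm_nonneg _
  have h2 : ‖polyToL2 hc R‖ ≤ |b| * δ := by
    rcases hR0.eq_or_lt with h | h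
    · rw [← h]
      positivity
    · exact le_of_mul_le_mul_left (by rwa [← sq]) h
  have h3 : ‖polyToL2 hc R‖ ^ 2 ≤ b ^ 2 * δ ^ 2 := by
    rw [← sq_abs b, ← mul_pow]
    exact pow_le_pow_left₀ hR0 h2 2
  have h4 : b ^ 2 ≤ 1 := by nlinarith [sq_nonneg ‖polyToL2 hc R‖]
  nlinarith [mul_le_mul_of_nonneg_right h4 (sq_nonneg δ)]

/-- Where `|P| > s`, the function `φ_n(|P|² μ)` is at most `s⁻¹ |P φ_n(|P|² μ)|`, and
`P φ_n(|P|² μ)` is a unit vector of `L²(μ)`. -/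
lemma norm_sq_orthoPoly_sqAbsMeasure_le {P : ℂ[X]} [IsFiniteMeasure (sqAbsMeasure P μ)]
    (hc : IsCompact μ.support)
    (hc' : IsCompact (sqAbsMeasure P μ).support) (hi' : (sqAbsMeasure P μ).support.Infinite)
    {s : ℝ} (hs : 0 < s) (n : ℕ) :
    ‖polyToL2 hc (orthoPoly (sqAbsMeasure P μ) n)‖ ^ 2 ≤ (s ^ 2)⁻¹ +
      ∫ z in {z | ‖P.eval z‖ ≤ s} ∩ μ.support, ‖(orthoPoly (sqAbsMeasure P μ) n).eval z‖ ^ 2 ∂μ := by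
  set ν := sqAbsMeasure P μ with hν
  set K := {z | ‖P.eval z‖ ≤ s} ∩ μ.support with hK
  have hKm : MeasurableSet K :=
    ((isClosed_le P.continuous.norm continuous_const).inter Measure.isClosed_support).measurableSet
  have hint : ∀ f : ℂ[X], Integrable (fun z => ‖f.eval z‖ ^ 2) μ := fun f =>
    (memLp_poly hc f).integrable_norm_pow two_ne_zero
  have hnorm : ∀ f : ℂ[X], ‖polyToL2 hc f‖ ^ 2 = ∫ z, ‖f.eval z‖ ^ 2 ∂μ := fun f => by
    rw [norm_polyToL2, Real.sq_sqrt (integral_nonneg fun z => by positivity)]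
  have h1 : ∫ z, ‖(P * orthoPoly ν n).eval z‖ ^ 2 ∂μ = 1 := by
    rw [← hnorm, ← norm_polyToL2_sqAbsMeasure P hc hc', norm_polyToL2_orthoPoly hc' hi', one_pow]
  rw [hnorm, ← integral_indicator hKm]
  calc ∫ z, ‖(orthoPoly ν n).eval z‖ ^ 2 ∂μ
      ≤ ∫ z, ((s ^ 2)⁻¹ * ‖(P * orthoPoly ν n).eval z‖ ^ 2 +
          K.indicator (fun z => ‖(orthoPoly ν n).eval z‖ ^ 2) z) ∂μ := by
        refine integral_mono_ae (hint _)
          (((hint _).const_mul _).add ((hint _).indicator hKm)) ?_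
        filter_upwards [Measure.support_mem_ae (μ := μ)] with z hz
        by_cases hzK : z ∈ K
        · rw [Set.indicator_of_mem hzK]
          exact le_add_of_nonneg_left (by positivity)
        · have hPz : s < ‖P.eval z‖ := not_le.1 fun h => hzK ⟨h, hz⟩
          rw [Set.indicator_of_notMem hzK, add_zero, eval_mul, norm_mul, mul_pow,
            le_inv_mul_iff₀ (by positivity)]
          gcongr
    _ = _ := by
        rw [integral_add ((hint _).const_mul _) ((hint _).indicator hKm), integral_const_mul, h1,
          mul_one]

/-- The mass of `φ_n(ν)` escapes from compact sets on which `∑ |φ_n(ν)|²` is bounded, for any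
finite measure `μ` in place of `ν`. -/
lemma tendsto_setIntegral_orthoPoly_sq {ν : Measure ℂ} {K : Set ℂ} (hK : IsCompact K) {C : ℝ}
    (hC : ∀ z ∈ K, ∀ N, ∑ n ∈ Finset.range N, ‖(orthoPoly ν n).eval z‖ ^ 2 ≤ C) :
    Tendsto (fun n => ∫ z in K, ‖(orthoPoly ν n).eval z‖ ^ 2 ∂μ) atTop (𝓝 0) := by
  have h0 : (0 : ℝ) = ∫ _ in K, (0 : ℝ) ∂μ := by simp
  rw [h0]
  refine tendsto_integral_of_dominated_convergence (fun _ => C)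
    (fun n => ((orthoPoly ν n).continuous.norm.pow 2).aestronglyMeasurable)
    (integrable_const C) (fun n => ?_) ?_
  · filter_upwards [ae_restrict_mem hK.measurableSet] with z hz
    rw [Real.norm_of_nonneg (by positivity)]
    refine le_trans ?_ (hC z hz (n + 1))
    exact Finset.single_le_sum (f := fun n => ‖(orthoPoly ν n).eval z‖ ^ 2)
      (fun _ _ => by positivity) (Finset.self_mem_range_succ n)
  · filter_upwards [ae_restrict_mem hK.measurableSet] with z hz
    exact (summable_of_sum_range_le (fun n => by positivity) (hC z hz)).tendsto_atTop_zero

lemma kappa_div_kappa_le {P : ℂ[X]} (hP : P.Monic) {r : ℝ} (hc : IsCompact μ.support)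
    (hi : μ.support.Infinite) (hμ : ∀ᵐ z ∂μ, ‖P.eval z‖ ≤ r) (n : ℕ) :
    kappa μ n / kappa μ (n + P.natDegree) ≤ r := by
  have h1 := norm_inner_le_norm (𝕜 := ℂ) (polyToL2 hc (orthoPoly μ (n + P.natDegree)))
    (polyToL2 hc (P * orthoPoly μ n))
  rw [inner_orthoPoly_mul_orthoPoly hP hc hi, norm_polyToL2_orthoPoly hc hi, one_mul,
    Complex.norm_real] at h1
  have h2 := norm_polyToL2_mul_le hc hμ (orthoPoly μ n)
  rw [norm_polyToL2_orthoPoly hc hi, mul_one] at h2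
  exact (le_abs_self _).trans (h1.trans h2)

lemma kappa_div_kappa_le_norm (hc : IsCompact μ.support)
    (hi : μ.support.Infinite) (ν : Measure ℂ) (n : ℕ) :
    kappa ν n / kappa μ n ≤ ‖polyToL2 hc (orthoPoly ν n)‖ := by
  have h1 := norm_inner_le_norm (𝕜 := ℂ) (polyToL2 hc (orthoPoly μ n))
    (polyToL2 hc (orthoPoly ν n))
  rw [inner_orthoPoly_eq_coeff_div hc hi (natDegree_orthoPoly_le ν n), coeff_orthoPoly_self,
    ← Complex.ofReal_div, norm_polyToL2_orthoPoly hc hi, one_mul, Complex.norm_real] at h1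
  exact (le_abs_self _).trans h1

lemma tendsto_kappa_div_kappa {P : ℂ[X]} (hP : P.Monic) {r : ℝ} (hr : 0 < r)
    (hc : IsCompact μ.support) (hi : μ.support.Infinite) (hμ : ∀ᵐ z ∂μ, ‖P.eval z‖ ≤ r)
    (hbound : ∀ K : Set ℂ, IsCompact K → K ⊆ {z : ℂ | ‖P.eval z‖ < r} →
      ∃ C : ℝ, ∀ z ∈ K, ∀ N : ℕ,
        ∑ n ∈ Finset.range N, ‖(orthoPoly (sqAbsMeasure P μ) n).eval z‖ ^ 2 ≤ C) :
    Tendsto (fun n : ℕ => kappa μ n / kappa μ (n + P.natDegree)) atTop (𝓝 r) := by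
  have hfin := isFiniteMeasure_sqAbsMeasure P hc
  have hc' := isCompact_support_sqAbsMeasure P hc
  have hi' := infinite_support_sqAbsMeasure hP.ne_zero hi
  set ν := sqAbsMeasure P μ with hν
  have hUo : IsOpen {z : ℂ | ‖P.eval z‖ < r} := isOpen_lt P.continuous.norm continuous_const
  have hlsb : LocallySquareBounded {z : ℂ | ‖P.eval z‖ < r} (orthoPoly μ) := by
    intro z₀ hz₀
    obtain ⟨ε, hε, hsub⟩ := Metric.nhds_basis_closedBall.mem_iff.1 (hUo.mem_nhds hz₀)
    obtain ⟨C, hC⟩ := hbound _ (isCompact_closedBall z₀ ε) hsub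
    refine ⟨ε, hε, r ^ 2 * C, fun z hz N => ?_⟩
    refine (sum_norm_orthoPoly_sq_le P hc hi hc' hi' hμ N z).trans ?_
    gcongr
    exact hC z hz N
  have hroots : ∀ a ∈ P.roots, a ∈ {z : ℂ | ‖P.eval z‖ < r} := fun a ha => by
    have h : P.eval a = 0 := (mem_roots'.1 ha).2
    simpa [h] using hr
  have hδ : Tendsto (fun n => ‖polyToL2 hc (orthoPoly μ (n + P.natDegree) %ₘ P)‖) atTop (𝓝 0) := by
    have h := ((hlsb.tendsto_modByMonic hc hP hroots).norm).comp (tendsto_add_atTop_nat P.natDegree)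
    simpa [Function.comp_def] using h
  refine tendsto_order.2 ⟨fun c hcr => ?_, fun c hcr =>
    Eventually.of_forall fun n => (kappa_div_kappa_le hP hc hi hμ n).trans_lt hcr⟩
  obtain ⟨s, hs, hsr⟩ := exists_between (max_lt hcr hr)
  have hs0 : 0 < s := (le_max_right _ _).trans_lt hs
  set K := {z | ‖P.eval z‖ ≤ s} ∩ μ.support with hK
  have hKc : IsCompact K := hc.inter_left (isClosed_le P.continuous.norm continuous_const)
  obtain ⟨C, hC⟩ := hbound K hKc fun z hz => lt_of_le_of_lt hz.1 hsr
  -- `(κ_n(μ) / κ_{n+q}(μ))²` dominates a sequence with limit `1 / s⁻² = s²`.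
  have hlim : Tendsto (fun n => (1 - ‖polyToL2 hc (orthoPoly μ (n + P.natDegree) %ₘ P)‖ ^ 2) /
      ((s ^ 2)⁻¹ + ∫ z in K, ‖(orthoPoly ν n).eval z‖ ^ 2 ∂μ)) atTop (𝓝 (s ^ 2)) := by
    have h := ((hδ.pow 2).const_sub 1).div
      ((tendsto_setIntegral_orthoPoly_sq (μ := μ) hKc hC).const_add (s ^ 2)⁻¹) (by positivity)
    simpa [Pi.div_def] using h
  have hcs : max c 0 ^ 2 < s ^ 2 := pow_lt_pow_left₀ hs (le_max_right _ _) two_ne_zero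
  filter_upwards [hlim.eventually_const_lt hcs] with n hn
  have hk1 := kappa_pos hc hi n
  have hk2 := kappa_pos hc hi (n + P.natDegree)
  have hk3 := kappa_pos hc' hi' n
  have hd : (kappa ν n / kappa μ n) ^ 2 ≤
      (s ^ 2)⁻¹ + ∫ z in K, ‖(orthoPoly ν n).eval z‖ ^ 2 ∂μ :=
    (pow_le_pow_left₀ (by positivity) (kappa_div_kappa_le_norm hc hi ν n) 2).trans
      (norm_sq_orthoPoly_sqAbsMeasure_le hc hc' hi' hs0 n)
  have hb := one_sub_sq_kappa_div_le hP hc hi hc' hi' n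
  have hfac : kappa ν n / kappa μ (n + P.natDegree) =
      kappa μ n / kappa μ (n + P.natDegree) * (kappa ν n / kappa μ n) := by
    field_simp
  have ha : max c 0 ^ 2 < (kappa μ n / kappa μ (n + P.natDegree)) ^ 2 := by
    refine hn.trans_le ((div_le_iff₀ (lt_of_lt_of_le (by positivity) hd)).2 (hb.trans ?_))
    rw [hfac, mul_pow]
    gcongr
  exact (le_max_left _ _).trans_lt (lt_of_pow_lt_pow_left₀ 2 (by positivity) ha)

end LeadingCoefficients

/-! ### Strong convergence of the operators -/

section Operators

variable {μ : Measure ℂ} [IsFiniteMeasure μ]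

lemma rightShift_pow_single (n k : ℕ) :
    (rightShift ^ n) (lp.single 2 k (1 : ℂ)) = lp.single 2 (k + n) (1 : ℂ) := by
  induction n with
  | zero => simp
  | succ n ih =>
    rw [pow_succ', mul_apply_eq_comp, ih]
    refine lp.ext (funext fun m => ?_)
    cases m with
    | zero =>
      rw [rightShift_zero, lp.single_apply_ne]
      omega
    | succ m =>
      rw [rightShift_succ, lp.coeFn_single, lp.coeFn_single, Pi.single_apply, Pi.single_apply,
        ← add_assoc]
      simp only [Nat.add_right_cancel_iff]

lemma norm_rightShift_pow_apply (n : ℕ) (x : ℓ²(ℕ, ℂ)) : ‖(rightShift ^ n) x‖ = ‖x‖ := by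
  have h1 : ∀ y : ℓ²(ℕ, ℂ), ‖rightShift y‖ = ‖y‖ := by
    intro y
    have h := (lp.hasSum_norm (p := 2) (by simp) (rightShift y)).unique (hasSum_shiftSeq y)
    simpa using h
  induction n with
  | zero => simp
  | succ n ih => rw [pow_succ', mul_apply_eq_comp, h1, ih]

/-- A polynomial as an element of `𝒫`. -/
noncomputable def polyVec (hc : IsCompact μ.support) : ℂ[X] →ₗ[ℂ] polySpace hc :=
  (polyToL2 hc).codRestrict _ fun p => Submodule.le_topologicalClosure _ ⟨p, rfl⟩

lemma repr_polyVec_orthoPoly (hc : IsCompact μ.support) (hi : μ.support.Infinite) (n : ℕ) :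
    (orthoBasis hc hi).repr (polyVec hc (orthoPoly μ n)) = lp.single 2 n (1 : ℂ) := by
  have h : polyVec hc (orthoPoly μ n) = orthoBasis hc hi n := by
    rw [orthoBasis, HilbertBasis.coe_mk]
    rfl
  rw [h, HilbertBasis.repr_self]

lemma aeval_shiftMatrix_repr (hc : IsCompact μ.support) (hi : μ.support.Infinite) (P f : ℂ[X]) :
    aeval (shiftMatrix hc hi) P ((orthoBasis hc hi).repr (polyVec hc f)) =
      (orthoBasis hc hi).repr (polyVec hc (P * f)) := by
  have hX : ∀ g : ℂ[X], shiftMatrix hc hi ((orthoBasis hc hi).repr (polyVec hc g)) =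
      (orthoBasis hc hi).repr (polyVec hc (X * g)) := by
    intro g
    change (orthoBasis hc hi).repr (mulZPoly hc
      ((orthoBasis hc hi).repr.symm ((orthoBasis hc hi).repr (polyVec hc g)))) = _
    rw [LinearIsometryEquiv.symm_apply_apply]
    congr 1
    exact Subtype.ext (mulZ_polyToL2 hc g)
  induction P using Polynomial.induction_on' generalizing f with
  | add p₁ p₂ h1 h2 =>
    rw [map_add, add_apply, h1, h2, add_mul, map_add, map_add]
  | monomial n a =>
    induction n generalizing f with
    | zero => simp [← smul_eq_C_mul]
    | succ n ih =>
      rw [← monomial_mul_X, map_mul, aeval_X, mul_apply_eq_comp, hX, ih, mul_assoc]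

lemma norm_aeval_shiftMatrix_sub_apply_single {P : ℂ[X]} {q : ℕ} (hc : IsCompact μ.support)
    (hi : μ.support.Infinite) (r : ℝ) (n : ℕ) :
    ‖(aeval (shiftMatrix hc hi) P - (r : ℂ) • rightShift ^ q) (lp.single 2 n (1 : ℂ))‖ =
      ‖polyToL2 hc (P * orthoPoly μ n - (r : ℂ) • orthoPoly μ (n + q))‖ := by
  rw [sub_apply, smul_apply, rightShift_pow_single,
    ← repr_polyVec_orthoPoly hc hi n, ← repr_polyVec_orthoPoly hc hi (n + q),
    aeval_shiftMatrix_repr, ← map_smul, ← map_smul, ← map_sub, ← map_sub,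
    LinearIsometryEquiv.norm_map]
  rfl

lemma tendsto_norm_mul_orthoPoly_sub {P : ℂ[X]} (hP : P.Monic) {r : ℝ}
    (hc : IsCompact μ.support) (hi : μ.support.Infinite) (hμ : ∀ᵐ z ∂μ, ‖P.eval z‖ ≤ r)
    (h : Tendsto (fun n : ℕ => kappa μ n / kappa μ (n + P.natDegree)) atTop (𝓝 r)) :
    Tendsto (fun n => ‖polyToL2 hc
      (P * orthoPoly μ n - (r : ℂ) • orthoPoly μ (n + P.natDegree))‖) atTop (𝓝 0) := by
  have hsq : Tendsto (fun n => ‖polyToL2 hc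
      (P * orthoPoly μ n - (r : ℂ) • orthoPoly μ (n + P.natDegree))‖ ^ 2) atTop (𝓝 0) := by
    have hlim : Tendsto (fun n => 2 * r ^ 2 - 2 * r * (kappa μ n / kappa μ (n + P.natDegree)))
        atTop (𝓝 0) := by
      have := (h.const_mul (2 * r)).const_sub (2 * r ^ 2)
      rwa [show 2 * r ^ 2 - 2 * r * r = 0 by ring] at this
    refine squeeze_zero (fun n => by positivity) (fun n => ?_) hlim
    have h1 := norm_polyToL2_mul_le hc hμ (orthoPoly μ n)
    rw [norm_polyToL2_orthoPoly hc hi, mul_one] at h1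
    have h2 := pow_le_pow_left₀ (norm_nonneg _) h1 2
    rw [map_sub, map_smul, @norm_sub_sq ℂ, inner_smul_right, ← inner_conj_symm,
      inner_orthoPoly_mul_orthoPoly hP hc hi, Complex.conj_ofReal, norm_smul,
      norm_polyToL2_orthoPoly hc hi, Complex.norm_real, mul_one, Real.norm_eq_abs, sq_abs,
      ← Complex.ofReal_mul]
    have hre : RCLike.re ((r * (kappa μ n / kappa μ (n + P.natDegree)) : ℝ) : ℂ) =
        r * (kappa μ n / kappa μ (n + P.natDegree)) := Complex.ofReal_re _
    rw [hre]
    linarith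
  have := hsq.sqrt
  simpa [Real.sqrt_sq (norm_nonneg _)] using this

/-- The operators `T ℛⁿ` are bounded by `‖T‖`, so it suffices to test strong convergence on the
standard basis, which `ℛⁿ` shifts to infinity. -/
lemma tendsto_mul_rightShift_pow {T : ℓ²(ℕ, ℂ) →L[ℂ] ℓ²(ℕ, ℂ)}
    (hT : Tendsto (fun n => ‖T (lp.single 2 n (1 : ℂ))‖) atTop (𝓝 0)) (x : ℓ²(ℕ, ℂ)) :
    Tendsto (fun n => (T * rightShift ^ n) x) atTop (𝓝 0) := by
  let S : Submodule ℂ ℓ²(ℕ, ℂ) :=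
    { carrier := {x | Tendsto (fun n => (T * rightShift ^ n) x) atTop (𝓝 0)}
      add_mem' := fun {x y} hx hy => by
        have h := Tendsto.add hx hy
        rw [add_zero] at h
        exact h.congr fun n => (map_add _ x y).symm
      zero_mem' := by simp
      smul_mem' := fun c x hx => by
        have h := Tendsto.const_smul hx c
        rw [smul_zero] at h
        exact h.congr fun n => (map_smul _ c x).symm }
  have hsingle : ∀ (k : ℕ) (c : ℂ), lp.single 2 k c ∈ S := by
    intro k c
    have h1 : lp.single 2 k (1 : ℂ) ∈ S := by
      change Tendsto _ _ _
      simp_rw [mul_apply_eq_comp, rightShift_pow_single]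
      have h := tendsto_zero_iff_norm_tendsto_zero.2 hT
      refine (h.comp (tendsto_add_atTop_nat k)).congr fun n => ?_
      rw [Function.comp_apply, add_comm]
    have h2 := S.smul_mem c h1
    rwa [← lp.single_smul, smul_eq_mul, mul_one] at h2
  have hclosed : IsClosed (S : Set ℓ²(ℕ, ℂ)) := by
    refine isClosed_of_closure_subset fun y hy => ?_
    refine Metric.tendsto_atTop.2 fun ε hε => ?_
    have hT0 : 0 < ‖T‖ + 1 := by positivity
    obtain ⟨w, hw, hyw⟩ := Metric.mem_closure_iff.1 hy (ε / 2 / (‖T‖ + 1)) (by positivity)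
    obtain ⟨N, hN⟩ := Metric.tendsto_atTop.1 hw (ε / 2) (half_pos hε)
    refine ⟨N, fun n hn => ?_⟩
    have h1 : ‖(T * rightShift ^ n) (y - w)‖ < ε / 2 := by
      rw [mul_apply_eq_comp]
      refine (T.le_opNorm _).trans_lt ?_
      rw [norm_rightShift_pow_apply, ← dist_eq_norm]
      rw [lt_div_iff₀ hT0] at hyw
      nlinarith [dist_nonneg (x := y) (y := w)]
    have h2 := hN n hn
    rw [dist_zero_right] at h2 ⊢
    calc ‖(T * rightShift ^ n) y‖
        = ‖(T * rightShift ^ n) (y - w) + (T * rightShift ^ n) w‖ := by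
          rw [← map_add, sub_add_cancel]
      _ < ε := (norm_add_le _ _).trans_lt (by linarith)
  exact hclosed.mem_of_tendsto (lp.hasSum_single (p := 2) (by simp) x)
    (Eventually.of_forall fun t => S.sum_mem fun k _ => hsingle k (x k))

end Operators

end Bergman

open Bergman in
theorem theorem1p6 (P : ℂ[X]) (hP : P.Monic) (q : ℕ) (hq : P.natDegree = q) (hq1 : 1 ≤ q)
    (r : ℝ) (hr : 0 < r)
    (μ : Measure ℂ) [IsFiniteMeasure μ] (hc : IsCompact μ.support) (hi : μ.support.Infinite)
    (hμ : μ {z : ℂ | ‖P.eval z‖ ≤ r}ᶜ = 0)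
    (hbound : ∀ K : Set ℂ, IsCompact K → K ⊆ {z : ℂ | ‖P.eval z‖ < r} →
      ∃ C : ℝ≥0, ∀ z ∈ K, ∑' n : ℕ, ‖(orthoPoly (sqAbsMeasure P μ) n).eval z‖ₑ ^ 2 < C) :
    (∀ x : ℓ²(ℕ, ℂ), Tendsto
      (fun n : ℕ => ((aeval (shiftMatrix hc hi) P - (r : ℂ) • rightShift ^ q) * rightShift ^ n) x)
      atTop (𝓝 0)) ∧
    Tendsto (fun n : ℕ => kappa μ n / kappa μ (n + q)) atTop (𝓝 r) := by
  subst hq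
  have hμ' : ∀ᵐ z ∂μ, ‖P.eval z‖ ≤ r := hμ
  have hlim := tendsto_kappa_div_kappa hP hr hc hi hμ' fun K hK hKU => by
    obtain ⟨C, hC⟩ := hbound K hK hKU
    refine ⟨C, fun z hz N => ?_⟩
    have h := (ENNReal.sum_le_tsum (Finset.range N)).trans (hC z hz).le
    simp only [enorm_eq_nnnorm] at h
    have h' : ∑ n ∈ Finset.range N, ‖(orthoPoly (sqAbsMeasure P μ) n).eval z‖₊ ^ 2 ≤ C := by
      exact_mod_cast h
    simpa using NNReal.coe_le_coe.2 h'
  refine ⟨tendsto_mul_rightShift_pow ?_, hlim⟩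
  simp_rw [norm_aeval_shiftMatrix_sub_apply_single]
  exact tendsto_norm_mul_orthoPoly_sub hP hc hi hμ' hlim
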